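/- Let $(R,\mathfrak m)$ be a commutative Noetherian local ring. A *pointed étale neighborhood* of $R$ is a flat local homomorphism $R\to A$ of local rings, with $A$ essentially of finite type over $R$, such that $A$ is separable over $R$ (that is, the diagonal map $A\otimes_R A\to A$, $a\otimes b\mapsto ab$, splits as a map of $A\otimes_R A$-modules) and $R\to A$ induces an isomorphism on residue fields. Let $R^{\mathrm h}$ be the Henselization of $R$, that is, the direct limit of the pointed étale neighborhoods of $R$ (up to $R$-isomorphism) along the $R$-algebra homomorphisms between them. Then for every finitely generated $R^{\mathrm h}$-module $N$ there is a finitely generated $R$-module $M$ such that $N$ is isomorphic, as an $R^{\mathrm h}$-module, to a direct summand of $R^{\mathrm h}\otimes_R M$. -/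

import Mathlib

open CategoryTheory CategoryTheory.Limits
open scoped TensorProduct

universe u v w

/-- An `R`-algebra `A` is separable if the diagonal map `A ⊗[R] A → A`, `a ⊗ b ↦ a * b`, splits as a
map of `A ⊗[R] A`-modules: it has an additive section `σ` that commutes with the action of
`A ⊗[R] A`, which acts on `A` through the diagonal map. -/
def IsSeparableAlgebra (R : Type u) (A : Type v) [CommRing R] [CommRing A] [Algebra R A] : Prop :=
  ∃ σ : A →+ A ⊗[R] A,
    (∀ (x : A ⊗[R] A) (a : A), σ (Algebra.TensorProduct.lmul' R x * a) = x * σ a) ∧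
      ∀ a : A, Algebra.TensorProduct.lmul' R (σ a) = a

/-- A local `R`-algebra `A` over the local ring `R` is a pointed étale neighborhood of `R` if
`R → A` is a flat local homomorphism, `A` is separable over `R` and essentially of finite type
over `R`, and `R → A` induces an isomorphism on residue fields. -/
structure IsPointedEtale (R : Type u) (A : Type v) [CommRing R] [IsLocalRing R]
    [CommRing A] [IsLocalRing A] [Algebra R A] : Prop where
  [isLocalHom : IsLocalHom (algebraMap R A)]
  flat : Module.Flat R A
  separable : IsSeparableAlgebra R A
  essFiniteType : Algebra.EssFiniteType R A
  residue_bijective : Function.Bijective (IsLocalRing.ResidueField.map (algebraMap R A))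

/-- Being a pointed étale neighborhood is invariant under isomorphism of `R`-algebras. -/
theorem IsPointedEtale.of_algEquiv {R : Type u} {A : Type v} {B : Type w} [CommRing R]
    [IsLocalRing R] [CommRing A] [IsLocalRing A] [Algebra R A] [CommRing B] [IsLocalRing B]
    [Algebra R B] (h : IsPointedEtale R A) (e : A ≃ₐ[R] B) : IsPointedEtale R B := by
  obtain ⟨hflat, ⟨σ, hσ, hσ'⟩, hfin, hres⟩ := h
  have hmap : algebraMap R B = (e.toRingEquiv : A →+* B).comp (algebraMap R A) := by
    ext r; simp
  have hloc : IsLocalHom (algebraMap R B) := by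
    rw [hmap]; infer_instance
  let t : A ⊗[R] A ≃ₐ[R] B ⊗[R] B := Algebra.TensorProduct.congr e e
  have ht : ∀ x : A ⊗[R] A,
      Algebra.TensorProduct.lmul' R (t x) = e (Algebra.TensorProduct.lmul' R x) := by
    intro x
    induction x with
    | zero => simp
    | tmul a b => simp [t]
    | add x y hx hy => simp [hx, hy]
  refine ⟨Module.Flat.of_linearEquiv e.symm.toLinearEquiv,
    ⟨(t : A ⊗[R] A →+ B ⊗[R] B).comp (σ.comp (e.symm : B →+ A)), ?_, ?_⟩,
    (Algebra.EssFiniteType.iff_of_algEquiv e).1 hfin, ?_⟩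
  · intro x b
    obtain ⟨y, rfl⟩ := t.surjective x
    obtain ⟨a, rfl⟩ := e.surjective b
    have : e.symm (Algebra.TensorProduct.lmul' R (t y) * e a) =
        Algebra.TensorProduct.lmul' R y * a := by
      rw [ht, ← map_mul, e.symm_apply_apply]
    simp [this, hσ]
  · intro b
    simp [ht, hσ']
  · have : IsLocalRing.ResidueField.map (algebraMap R B) =
        (IsLocalRing.ResidueField.mapEquiv e.toRingEquiv : _ →+* _).comp
          (IsLocalRing.ResidueField.map (algebraMap R A)) := by
      ext r
      obtain ⟨r, rfl⟩ := IsLocalRing.residue_surjective r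
      simp [IsLocalRing.ResidueField.mapEquiv]
    rw [this]
    exact (IsLocalRing.ResidueField.mapEquiv e.toRingEquiv).bijective.comp hres

/-- A small family containing, up to `R`-isomorphism, all pointed étale neighborhoods of `R`
(see `PointedEtaleNbhd.exists_algEquiv`): those of the form `(R[X₁, …, Xₙ] ⧸ I)_p`. -/
structure PointedEtaleNbhd (R : Type u) [CommRing R] [IsLocalRing R] : Type u where
  n : ℕ
  I : Ideal (MvPolynomial (Fin n) R)
  p : Ideal (MvPolynomial (Fin n) R ⧸ I)
  [isPrime : p.IsPrime]
  isPointedEtale : IsPointedEtale R (Localization.AtPrime p)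

namespace PointedEtaleNbhd

attribute [instance] PointedEtaleNbhd.isPrime

variable (R : Type u) [CommRing R] [IsLocalRing R]

/-- Every pointed étale neighborhood of `R`, in any universe, is `R`-isomorphic to a member of the
family `PointedEtaleNbhd R`. -/
theorem exists_algEquiv {A : Type v} [CommRing A] [IsLocalRing A] [Algebra R A]
    (h : IsPointedEtale R A) :
    ∃ j : PointedEtaleNbhd R, Nonempty (A ≃ₐ[R] Localization.AtPrime j.p) := by
  have := h.essFiniteType
  obtain ⟨n, f, hf⟩ := Algebra.FiniteType.iff_quotient_mvPolynomial''.1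
    (inferInstance : Algebra.FiniteType R (Algebra.EssFiniteType.subalgebra R A))
  let I := RingHom.ker f
  let e : (MvPolynomial (Fin n) R ⧸ I) ≃ₐ[R] Algebra.EssFiniteType.subalgebra R A :=
    Ideal.quotientKerAlgEquivOfSurjective hf
  let g : (MvPolynomial (Fin n) R ⧸ I) →ₐ[R] A := (Subalgebra.val _).comp e.toAlgHom
  let p : Ideal (MvPolynomial (Fin n) R ⧸ I) := (IsLocalRing.maximalIdeal A).comap g
  have hp : p.IsPrime := Ideal.comap_isPrime _ _
  let _ : Algebra (MvPolynomial (Fin n) R ⧸ I) A := g.toRingHom.toAlgebra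
  have : IsScalarTower R (MvPolynomial (Fin n) R ⧸ I) A :=
    IsScalarTower.of_algebraMap_eq fun r ↦ (g.commutes r).symm
  have : IsLocalization.AtPrime A p := by
    have h1 := IsLocalization.isLocalization_of_base_ringEquiv
      (Algebra.EssFiniteType.submonoid R A) A e.symm.toRingEquiv
    have h2 : (Algebra.EssFiniteType.submonoid R A).map e.symm.toRingEquiv = p.primeCompl := by
      ext x
      constructor
      · rintro ⟨y, hy, rfl⟩
        have : g (e.symm y) = y := by simp [g]
        have hy' : IsUnit (y : A) := hy
        simpa [p, Ideal.primeCompl, this] using hy'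
      · intro hx
        refine ⟨e x, ?_, by simp⟩
        have : g x = e x := rfl
        have hx' : IsUnit (e x : A) := by simpa [p, Ideal.primeCompl, this] using hx
        exact hx'
    rw [h2] at h1
    exact h1
  let E : A ≃ₐ[R] Localization.AtPrime p :=
    (IsLocalization.algEquiv p.primeCompl A (Localization.AtPrime p)).restrictScalars R
  exact ⟨⟨n, I, p, h.of_algEquiv E⟩, ⟨E⟩⟩

/-- The underlying `R`-algebra of a pointed étale neighborhood. -/
noncomputable def toCommAlgCat (j : PointedEtaleNbhd R) : CommAlgCat.{u} R :=
  CommAlgCat.of R (Localization.AtPrime j.p)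

/-- The morphisms between pointed étale neighborhoods are the `R`-algebra homomorphisms. -/
noncomputable instance : Category.{u} (PointedEtaleNbhd R) :=
  inferInstanceAs (Category (InducedCategory (CommAlgCat.{u} R) (toCommAlgCat R)))

/-- The system of all pointed étale neighborhoods of `R` and all `R`-algebra homomorphisms
between them. -/
noncomputable def system : PointedEtaleNbhd R ⥤ CommAlgCat.{u} R :=
  inducedFunctor (toCommAlgCat R)

end PointedEtaleNbhd

/-- The Henselization of the local ring `R`, as an `R`-algebra: the direct limit of its pointed
étale neighborhoods. -/
noncomputable def Henselization (R : Type u) [CommRing R] [IsLocalRing R] : Type u :=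
  (colimit (PointedEtaleNbhd.system R) : CommAlgCat.{u} R)

noncomputable instance (R : Type u) [CommRing R] [IsLocalRing R] : CommRing (Henselization R) :=
  inferInstanceAs (CommRing (colimit (PointedEtaleNbhd.system R) : CommAlgCat.{u} R))

noncomputable instance (R : Type u) [CommRing R] [IsLocalRing R] : Algebra R (Henselization R) :=
  inferInstanceAs (Algebra R (colimit (PointedEtaleNbhd.system R) : CommAlgCat.{u} R))

/-- The `S`-module `L` is extended from `R` if it is isomorphic to `S ⊗[R] M` for some finitely
generated `R`-module `M`. (The universe of `M` is no restriction: a finitely generated `R`-module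
is isomorphic to a quotient of some `Rⁿ`.) -/
def IsExtended (R : Type u) (S : Type v) [CommRing R] [CommRing S] [Algebra R S]
    (L : Type w) [AddCommGroup L] [Module S L] : Prop :=
  ∃ (M : Type u) (_ : AddCommGroup M) (_ : Module R M),
    Module.Finite R M ∧ Nonempty (S ⊗[R] M ≃ₗ[S] L)

/-- The `S`-module `N` is isomorphic to a direct summand of the `S`-module `L`. -/
def IsDirectSummand (S : Type u) [CommRing S] (N : Type v) [AddCommGroup N] [Module S N]
    (L : Type w) [AddCommGroup L] [Module S L] : Prop :=
  ∃ P Q : Submodule S L, IsCompl P Q ∧ Nonempty (N ≃ₗ[S] P)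

/-! Let `S` be the Henselization of `R`. Since `S` is Noetherian, `N` has a finite presentation, and
its finitely many relation coefficients already live in one pointed étale neighborhood `A`. So `N`
is the base change of a finite `A`-module `V`. The separability element of `A` gives an `A`-linear
section of `A ⊗[R] V → V`. The section sends generators of `V` into `A ⊗[R] M` for a finitely
generated `R`-submodule `M` of `V`, which is a submodule of `A ⊗[R] V` by flatness. Hence `V` is a
retract of `A ⊗[R] M`, and extending scalars to `S` makes `N` a retract of `S ⊗[R] M`
(`exists_retract_baseChange`).

Two facts about `S` support this. The system of neighborhoods is filtered: two of them map to a
localization of their tensor product, and parallel maps coincide because neighborhoods are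
unramified with the same residue field. And `S` is Noetherian (`Henselization.isNoetherianRing`):
`R` is dense in `S` and finitely generated ideals are closed, so finite generation can be tested on
leading forms in the Noetherian Rees algebra of the maximal ideal. -/

/-! ### Separable and unramified algebras -/

theorem IsSeparableAlgebra.formallyUnramified {R : Type u} {A : Type v} [CommRing R] [CommRing A]
    [Algebra R A] [Algebra.EssFiniteType R A] (h : IsSeparableAlgebra R A) :
    Algebra.FormallyUnramified R A := by
  obtain ⟨σ, hσ, hσ'⟩ := h
  refine Algebra.FormallyUnramified.iff_exists_tensorProduct.2 ⟨σ 1, fun s ↦ ?_, hσ' 1⟩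
  rw [← hσ]
  simp

theorem IsSeparableAlgebra.of_formallyUnramified {R : Type u} {A : Type v} [CommRing R]
    [CommRing A] [Algebra R A] [Algebra.EssFiniteType R A] [Algebra.FormallyUnramified R A] :
    IsSeparableAlgebra R A := by
  obtain ⟨t, ht, ht'⟩ := Algebra.FormallyUnramified.iff_exists_tensorProduct.1
    (inferInstance : Algebra.FormallyUnramified R A)
  -- The section is `a ↦ (a ⊗ 1) * t`; it is linear because `1 ⊗ c` and `c ⊗ 1` act alike on `t`.
  refine ⟨(AddMonoidHom.mulRight t).comp
    (Algebra.TensorProduct.includeLeft : A →ₐ[R] A ⊗[R] A), fun x a ↦ ?_, fun a ↦ ?_⟩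
  · induction x with
    | zero => simp
    | tmul b c =>
      have hc : (1 : A) ⊗ₜ[R] c * t = c ⊗ₜ[R] (1 : A) * t := by
        rw [← sub_eq_zero, ← sub_mul, ht]
      have h1 : b ⊗ₜ[R] c * (a ⊗ₜ[R] (1 : A) * t) =
          (b * a) ⊗ₜ[R] (1 : A) * ((1 : A) ⊗ₜ[R] c * t) := by
        simp [← mul_assoc]
      simp only [AddMonoidHom.coe_comp, Function.comp_apply, AddMonoidHom.coe_mulRight,
        AddMonoidHom.coe_coe, Algebra.TensorProduct.includeLeft_apply,
        Algebra.TensorProduct.lmul'_apply_tmul]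
      rw [h1, hc, ← mul_assoc]
      simp [mul_right_comm]
    | add x y hx hy => simp only [map_add, add_mul, hx, hy]
  · simp [ht']

/-- Two homomorphisms from an unramified algebra to a local algebra agree as soon as they agree
modulo the maximal ideal. -/
theorem Algebra.FormallyUnramified.algHom_ext_of_residue {R : Type u} {A : Type v} {B : Type w}
    [CommRing R] [CommRing A] [CommRing B] [IsLocalRing B] [Algebra R A] [Algebra R B]
    [Algebra.EssFiniteType R A] [Algebra.FormallyUnramified R A] {f g : A →ₐ[R] B}
    (h : ∀ a, f a - g a ∈ IsLocalRing.maximalIdeal B) : f = g := by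
  obtain ⟨t, ht, ht'⟩ := Algebra.FormallyUnramified.iff_exists_tensorProduct.1
    (inferInstance : Algebra.FormallyUnramified R A)
  let φ : A ⊗[R] A →ₐ[R] B := Algebra.TensorProduct.lift f g fun _ _ ↦ .all _ _
  have hφ (x : A ⊗[R] A) :
      φ x - f (Algebra.TensorProduct.lmul' R x) ∈ IsLocalRing.maximalIdeal B := by
    induction x with
    | zero => simp
    | tmul a b =>
      have : φ (a ⊗ₜ b) - f (Algebra.TensorProduct.lmul' R (a ⊗ₜ[R] b)) = -f a * (f b - g b) := by
        simp [φ]; ring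
      rw [this]
      exact Ideal.mul_mem_left _ _ (h b)
    | add x y hx hy =>
      simp only [map_add]
      rw [add_sub_add_comm]
      exact add_mem hx hy
  -- Modulo the maximal ideal, `φ t` is `f 1 = 1`; being a unit that annihilates `g a - f a`, it
  -- forces equality.
  have hu : IsUnit (φ t) := by
    by_contra hn
    have := sub_mem ((IsLocalRing.mem_maximalIdeal _).2 hn) (hφ t)
    rw [ht', map_one, sub_sub_cancel] at this
    exact (Ideal.ne_top_iff_one _).1 (IsLocalRing.maximalIdeal.isMaximal B).ne_top this
  ext a
  have := congrArg φ (ht a)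
  rw [map_mul, map_zero] at this
  have := (hu.mul_left_eq_zero).1 this
  exact (sub_eq_zero.1 (by simpa [φ] using this)).symm

/-! ### Properties of pointed étale neighborhoods -/

namespace IsPointedEtale

open IsLocalRing

section

variable {R : Type u} {A : Type v} {B : Type w} [CommRing R] [IsLocalRing R] [CommRing A]
  [IsLocalRing A] [Algebra R A] [CommRing B] [IsLocalRing B] [Algebra R B]

theorem formallyUnramified (h : IsPointedEtale R A) : Algebra.FormallyUnramified R A :=
  have := h.essFiniteType
  h.separable.formallyUnramified

theorem map_maximalIdeal (h : IsPointedEtale R A) :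
    (maximalIdeal R).map (algebraMap R A) = maximalIdeal A :=
  have := h.essFiniteType
  have := h.isLocalHom
  have := h.formallyUnramified
  Algebra.FormallyUnramified.map_maximalIdeal

theorem exists_sub_mem_maximalIdeal (h : IsPointedEtale R A) (a : A) :
    ∃ r : R, a - algebraMap R A r ∈ maximalIdeal A := by
  have := h.isLocalHom
  obtain ⟨y, hy⟩ := h.residue_bijective.2 (residue A a)
  obtain ⟨r, rfl⟩ := residue_surjective y
  refine ⟨r, ?_⟩
  rw [← residue_eq_zero_iff, map_sub, ← hy, ResidueField.map_residue, sub_self]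

/-- Every `a` is congruent to some `r` from `R`, so both maps send `a` to the class of `r` in the
residue field of `B`. -/
theorem algHom_ext (hA : IsPointedEtale R A) (hB : IsPointedEtale R B) (f g : A →ₐ[R] B) :
    f = g := by
  have := hA.essFiniteType
  have := hA.formallyUnramified
  have := hB.isLocalHom
  have key (f : A →ₐ[R] B) : maximalIdeal A ≤ (maximalIdeal B).comap f := by
    rw [← hA.map_maximalIdeal, Ideal.map_le_iff_le_comap]
    intro r hr
    simpa using hr
  refine Algebra.FormallyUnramified.algHom_ext_of_residue fun a ↦ ?_
  obtain ⟨r, hr⟩ := hA.exists_sub_mem_maximalIdeal a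
  have := sub_mem (Ideal.mem_comap.1 (key f hr)) (Ideal.mem_comap.1 (key g hr))
  simpa using this

theorem faithfullyFlat (h : IsPointedEtale R A) : Module.FaithfullyFlat R A :=
  have := h.isLocalHom
  have := h.flat
  Module.FaithfullyFlat.of_flat_of_isLocalHom

theorem algebraMap_mem_map_iff (h : IsPointedEtale R A) (I : Ideal R) (r : R) :
    algebraMap R A r ∈ I.map (algebraMap R A) ↔ r ∈ I := by
  have := h.faithfullyFlat
  rw [← Ideal.mem_comap, Ideal.comap_map_eq_self_of_faithfullyFlat]

theorem self : IsPointedEtale R R where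
  flat := inferInstance
  separable := .of_formallyUnramified
  essFiniteType := inferInstance
  isLocalHom := by rw [Algebra.algebraMap_self]; infer_instance
  residue_bijective := by
    have : ResidueField.map (algebraMap R R) = RingHom.id _ := ResidueField.map_id
    rw [this]
    exact Function.bijective_id

end

/-- The localization of `A ⊗ B` at the kernel of its map to the residue field. -/
theorem exists_upperBound {R A B : Type u} [CommRing R] [IsLocalRing R] [CommRing A]
    [IsLocalRing A] [Algebra R A] [CommRing B] [IsLocalRing B] [Algebra R B]
    (hA : IsPointedEtale R A) (hB : IsPointedEtale R B) :
    ∃ (C : Type u) (_ : CommRing C) (_ : IsLocalRing C) (_ : Algebra R C),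
      IsPointedEtale R C ∧ Nonempty (A →ₐ[R] C) ∧ Nonempty (B →ₐ[R] C) := by
  have toResidue {A : Type u} [CommRing A] [IsLocalRing A] [Algebra R A]
      (hA : IsPointedEtale R A) : Nonempty (A →ₐ[R] ResidueField R) := by
    have := hA.isLocalHom
    let e := RingEquiv.ofBijective _ hA.residue_bijective
    refine ⟨{ toRingHom := (e.symm : ResidueField A →+* ResidueField R).comp (residue A),
              commutes' := fun r ↦ ?_ }⟩
    change e.symm (residue A (algebraMap R A r)) = residue R r
    rw [RingEquiv.symm_apply_eq]
    rfl
  obtain ⟨ρA⟩ := toResidue hA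
  obtain ⟨ρB⟩ := toResidue hB
  let T := A ⊗[R] B
  let ρ : T →ₐ[R] ResidueField R := Algebra.TensorProduct.lift ρA ρB fun _ _ ↦ .all _ _
  let P : Ideal T := RingHom.ker ρ
  have hP : P.IsPrime := RingHom.ker_isPrime ρ
  let C := Localization.AtPrime P
  have mem_P {r : R} : algebraMap R T r ∈ P ↔ r ∈ maximalIdeal R := by
    rw [RingHom.mem_ker, AlgHom.commutes]
    exact residue_eq_zero_iff r
  have hloc : IsLocalHom (algebraMap R C) := by
    refine ⟨fun r hr ↦ ?_⟩
    rw [IsScalarTower.algebraMap_apply R T C,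
      IsLocalization.AtPrime.isUnit_to_map_iff C P] at hr
    by_contra hn
    exact hr (mem_P.2 hn)
  have := hA.essFiniteType
  have := hB.essFiniteType
  have := hA.formallyUnramified
  have := hB.formallyUnramified
  have := hA.flat
  have := hB.flat
  have : Algebra.EssFiniteType R T := .comp R A T
  have : Algebra.FormallyUnramified R T := .comp R A T
  have : Algebra.EssFiniteType R C := inferInstance
  have : Algebra.FormallyUnramified R C := inferInstance
  have : Module.Flat R T := .trans R A T
  have : Module.Flat T C := IsLocalization.flat C P.primeCompl
  have key (x : T) : ∃ r : R, x - algebraMap R T r ∈ P := by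
    obtain ⟨r, hr⟩ := residue_surjective (ρ x)
    refine ⟨r, ?_⟩
    rw [RingHom.mem_ker, map_sub, AlgHom.commutes, ← hr]
    exact sub_self _
  have hPC {x : T} : algebraMap T C x ∈ maximalIdeal C ↔ x ∈ P :=
    IsLocalization.AtPrime.to_map_mem_maximal_iff C P x
  refine ⟨C, inferInstance, inferInstance, inferInstance,
    ⟨.trans R T C, .of_formallyUnramified, inferInstance, RingHom.injective _, ?_⟩,
    ⟨(IsScalarTower.toAlgHom R T C).comp Algebra.TensorProduct.includeLeft⟩,
    ⟨(IsScalarTower.toAlgHom R T C).comp Algebra.TensorProduct.includeRight⟩⟩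
  have lift (x : T) : ∃ r : R, residue C (algebraMap R C r) = residue C (algebraMap T C x) := by
    obtain ⟨r, hr⟩ := key x
    refine ⟨r, ?_⟩
    rw [eq_comm, ← sub_eq_zero, ← map_sub, residue_eq_zero_iff,
      IsScalarTower.algebraMap_apply R T C, ← map_sub, hPC]
    exact hr
  intro y
  obtain ⟨c, rfl⟩ := residue_surjective y
  obtain ⟨x, s, rfl⟩ := IsLocalization.exists_mk'_eq P.primeCompl c
  obtain ⟨r, hr⟩ := lift x
  obtain ⟨q, hq⟩ := lift s
  refine ⟨residue R r / residue R q, ?_⟩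
  have hs : residue C (algebraMap T C s) ≠ 0 := by
    rw [Ne, residue_eq_zero_iff, hPC]
    exact s.2
  rw [map_div₀, ResidueField.map_residue, ResidueField.map_residue, hr, hq, div_eq_iff hs,
    ← map_mul, IsLocalization.mk'_spec]

end IsPointedEtale

theorem AlgHom.apply_mem_map_algebraMap {R : Type u} {A : Type v} {B : Type w} [CommRing R]
    [CommRing A] [CommRing B] [Algebra R A] [Algebra R B] (f : A →ₐ[R] B) {I : Ideal R} {a : A}
    (ha : a ∈ I.map (algebraMap R A)) : f a ∈ I.map (algebraMap R B) := by
  rw [← f.comp_algebraMap, ← Ideal.map_map]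
  exact Ideal.mem_map_of_mem _ ha

/-! ### The filtered system of neighborhoods -/

namespace PointedEtaleNbhd

variable {R : Type u} [CommRing R] [IsLocalRing R]

/-- The underlying ring of a pointed étale neighborhood. -/
def carrier (j : PointedEtaleNbhd R) : Type u := Localization.AtPrime j.p

noncomputable instance (j : PointedEtaleNbhd R) : CommRing j.carrier :=
  inferInstanceAs (CommRing (Localization.AtPrime j.p))

noncomputable instance (j : PointedEtaleNbhd R) : Algebra R j.carrier :=
  inferInstanceAs (Algebra R (Localization.AtPrime j.p))

instance (j : PointedEtaleNbhd R) : IsLocalRing j.carrier :=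
  inferInstanceAs (IsLocalRing (Localization.AtPrime j.p))

instance [IsNoetherianRing R] (j : PointedEtaleNbhd R) : IsNoetherianRing j.carrier :=
  inferInstanceAs (IsNoetherianRing (Localization.AtPrime j.p))

theorem isPointedEtale_carrier (j : PointedEtaleNbhd R) : IsPointedEtale R j.carrier :=
  j.isPointedEtale

theorem exists_algHom_to_common (i j : PointedEtaleNbhd R) :
    ∃ k : PointedEtaleNbhd R, Nonempty (i.carrier →ₐ[R] k.carrier) ∧
      Nonempty (j.carrier →ₐ[R] k.carrier) := by
  obtain ⟨C, _, _, _, hC, ⟨f⟩, ⟨g⟩⟩ := i.isPointedEtale_carrier.exists_upperBound j.isPointedEtale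
  obtain ⟨k, ⟨e⟩⟩ := exists_algEquiv R hC
  exact ⟨k, ⟨e.toAlgHom.comp f⟩, ⟨e.toAlgHom.comp g⟩⟩

/-- The morphism of pointed étale neighborhoods given by a homomorphism of `R`-algebras. -/
noncomputable def homMk {i j : PointedEtaleNbhd R}
    (f : i.carrier →ₐ[R] j.carrier) : i ⟶ j :=
  InducedCategory.homMk (F := toCommAlgCat R) (CommAlgCat.ofHom f)

theorem hom_ext {i j : PointedEtaleNbhd R} (f g : i ⟶ j) : f = g :=
  InducedCategory.hom_ext (F := toCommAlgCat R) <| CommAlgCat.hom_ext <|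
    i.isPointedEtale_carrier.algHom_ext j.isPointedEtale _ _

instance : Nonempty (PointedEtaleNbhd R) :=
  ⟨(exists_algEquiv R (IsPointedEtale.self (R := R))).choose⟩

instance : IsFiltered (PointedEtaleNbhd R) where
  cocone_objs i j := by
    obtain ⟨k, ⟨f⟩, ⟨g⟩⟩ := exists_algHom_to_common i j
    exact ⟨k, homMk f, homMk g, trivial⟩
  cocone_maps i j f g := ⟨j, 𝟙 j, hom_ext _ _⟩

end PointedEtaleNbhd

/-- This is what allows elements of the Henselization, and equalities between them, to be realized
in a single neighborhood. -/
instance CommAlgCat.preservesFilteredColimits_forget (R : Type u) [CommRing R] :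
    PreservesFilteredColimits (forget (CommAlgCat.{u} R)) :=
  have : PreservesFilteredColimits (Under.forget (CommRingCat.of R) ⋙ forget CommRingCat.{u}) :=
    comp_preservesFilteredColimits _ _
  comp_preservesFilteredColimits (commAlgCatEquivUnder (CommRingCat.of R)).functor
    (Under.forget (CommRingCat.of R) ⋙ forget CommRingCat.{u})

/-! ### Elements of the Henselization -/

namespace Henselization

variable {R : Type u} [CommRing R] [IsLocalRing R]

/-- The canonical map from a pointed étale neighborhood to the Henselization. -/
noncomputable def ι (j : PointedEtaleNbhd R) : j.carrier →ₐ[R] Henselization R :=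
  (colimit.ι (PointedEtaleNbhd.system R) j).hom

theorem ι_map {i j : PointedEtaleNbhd R}
    (f : i.carrier →ₐ[R] j.carrier) (a : i.carrier) :
    ι j (f a) = ι i a :=
  ConcreteCategory.congr_hom
    (colimit.w (PointedEtaleNbhd.system R) (PointedEtaleNbhd.homMk f)) a

theorem exists_rep (x : Henselization R) : ∃ (j : PointedEtaleNbhd R) (a : _), ι j a = x :=
  Concrete.colimit_exists_rep (PointedEtaleNbhd.system R) x

theorem exists_map_eq_of_ι_eq {j : PointedEtaleNbhd R} {a b : j.carrier}
    (h : ι j a = ι j b) : ∃ (k : PointedEtaleNbhd R)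
      (f : j.carrier →ₐ[R] k.carrier), f a = f b := by
  obtain ⟨k, f, g, hfg⟩ := Concrete.colimit_exists_of_rep_eq (PointedEtaleNbhd.system R) a b h
  obtain rfl := PointedEtaleNbhd.hom_ext f g
  exact ⟨k, ((PointedEtaleNbhd.system R).map f).hom, hfg⟩

theorem directed_range_ι :
    Directed (· ≤ ·) fun j : PointedEtaleNbhd R ↦ (ι j).range := by
  intro i j
  obtain ⟨k, ⟨f⟩, ⟨g⟩⟩ := PointedEtaleNbhd.exists_algHom_to_common i j
  refine ⟨k, ?_, ?_⟩ <;> rintro _ ⟨a, rfl⟩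
  exacts [⟨f a, ι_map f a⟩, ⟨g a, ι_map g a⟩]

theorem exists_common_rep {σ : Type*} [Finite σ] (x : σ → Henselization R) :
    ∃ (j : PointedEtaleNbhd R) (a : σ → j.carrier), ∀ s, ι j (a s) = x s := by
  choose i a ha using fun s ↦ exists_rep (x s)
  obtain ⟨j, hj⟩ := directed_range_ι.finite_le i
  choose b hb using fun s ↦ hj s ⟨a s, ha s⟩
  exact ⟨j, b, hb⟩

open IsLocalRing

theorem exists_sub_mem_map_maximalIdeal (x : Henselization R) :
    ∃ r : R, x - algebraMap R _ r ∈ (maximalIdeal R).map (algebraMap R (Henselization R)) := by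
  obtain ⟨j, a, rfl⟩ := exists_rep x
  obtain ⟨r, hr⟩ := j.isPointedEtale_carrier.exists_sub_mem_maximalIdeal a
  rw [← j.isPointedEtale_carrier.map_maximalIdeal] at hr
  refine ⟨r, ?_⟩
  simpa only [map_sub, AlgHom.commutes] using (ι j).apply_mem_map_algebraMap hr

end Henselization

/-! ### Density, leading forms and a Noetherian criterion -/

section adic

variable {R : Type u} {S : Type v} [CommRing R] [CommRing S] [Algebra R S] {I : Ideal R}

theorem Ideal.exists_sub_mem_map_pow_succ
    (h : ∀ x : S, ∃ r : R, x - algebraMap R S r ∈ I.map (algebraMap R S)) (n : ℕ) {x : S}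
    (hx : x ∈ (I ^ n).map (algebraMap R S)) :
    ∃ r ∈ I ^ n, x - algebraMap R S r ∈ (I ^ (n + 1)).map (algebraMap R S) := by
  induction hx using Submodule.span_induction with
  | mem x hx =>
    obtain ⟨r, hr, rfl⟩ := hx
    exact ⟨r, hr, by simp⟩
  | zero => exact ⟨0, zero_mem _, by simp⟩
  | add x y _ _ hx hy =>
    obtain ⟨r, hr, hxr⟩ := hx
    obtain ⟨q, hq, hyq⟩ := hy
    refine ⟨r + q, add_mem hr hq, ?_⟩
    rw [map_add, add_sub_add_comm]
    exact add_mem hxr hyq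
  | smul s x _ hx =>
    obtain ⟨r, hr, hxr⟩ := hx
    obtain ⟨q, hq⟩ := h s
    refine ⟨q * r, Ideal.mul_mem_left _ _ hr, ?_⟩
    have h1 : (s - algebraMap R S q) * algebraMap R S r ∈ (I ^ (n + 1)).map (algebraMap R S) := by
      rw [pow_succ', Ideal.map_mul]
      exact Ideal.mul_mem_mul hq (Ideal.mem_map_of_mem _ hr)
    have h2 : s • x - algebraMap R S (q * r) =
        s * (x - algebraMap R S r) + (s - algebraMap R S q) * algebraMap R S r := by
      rw [smul_eq_mul, map_mul]; ring
    rw [h2]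
    exact add_mem (Ideal.mul_mem_left _ _ hxr) h1

theorem Ideal.exists_sub_mem_map_pow
    (h : ∀ x : S, ∃ r : R, x - algebraMap R S r ∈ I.map (algebraMap R S)) (n : ℕ) (x : S) :
    ∃ r : R, x - algebraMap R S r ∈ (I ^ n).map (algebraMap R S) := by
  induction n with
  | zero => exact ⟨0, by simp [Ideal.map_top]⟩
  | succ n ih =>
    obtain ⟨r, hr⟩ := ih
    obtain ⟨q, -, hq⟩ := Ideal.exists_sub_mem_map_pow_succ h n hr
    exact ⟨r + q, by rwa [map_add, ← sub_sub]⟩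

/-- By density, the coefficients in `S` of a combination of elements of `J` may be replaced by
elements of `R`. -/
theorem Ideal.exists_mem_sub_mem_map_pow {A : Type w} [CommRing A] [Algebra R A] (φ : A →ₐ[R] S)
    (h : ∀ x : S, ∃ r : R, x - algebraMap R S r ∈ I.map (algebraMap R S)) (n : ℕ) {J : Ideal A}
    {x : S} (hx : x ∈ J.map φ) : ∃ b ∈ J, x - φ b ∈ (I ^ n).map (algebraMap R S) := by
  induction hx using Submodule.span_induction with
  | mem x hx =>
    obtain ⟨b, hb, rfl⟩ := hx
    exact ⟨b, hb, by simp⟩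
  | zero => exact ⟨0, zero_mem _, by simp⟩
  | add x y _ _ hx hy =>
    obtain ⟨b, hb, hxb⟩ := hx
    obtain ⟨c, hc, hyc⟩ := hy
    refine ⟨b + c, add_mem hb hc, ?_⟩
    rw [map_add, add_sub_add_comm]
    exact add_mem hxb hyc
  | smul s x _ hx =>
    obtain ⟨b, hb, hxb⟩ := hx
    obtain ⟨r, hr⟩ := Ideal.exists_sub_mem_map_pow h n s
    refine ⟨algebraMap R A r * b, Ideal.mul_mem_left _ _ hb, ?_⟩
    have : s • x - φ (algebraMap R A r * b) =
        s * (x - φ b) + φ b * (s - algebraMap R S r) := by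
      rw [smul_eq_mul, map_mul, AlgHom.commutes]; ring
    rw [this]
    exact add_mem (Ideal.mul_mem_left _ _ hxb) (Ideal.mul_mem_left _ _ hr)

/-- The ideal of the Rees algebra of `I` formed by the leading forms of the elements of `J`, an
ideal of an `R`-algebra. -/
def Ideal.leadingForms (I : Ideal R) (J : Ideal S) : Ideal (reesAlgebra I) where
  carrier := {f | ∀ n, algebraMap R S ((f : Polynomial R).coeff n) ∈
    J ⊔ (I ^ (n + 1)).map (algebraMap R S)}
  zero_mem' n := by simp
  add_mem' {f g} hf hg n := by
    simpa using add_mem (hf n) (hg n)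
  smul_mem' := by
    intro g f hf n
    rw [smul_eq_mul, MulMemClass.coe_mul, Polynomial.coeff_mul, map_sum]
    refine Submodule.sum_mem _ fun ij hij ↦ ?_
    rw [← Finset.HasAntidiagonal.mem_antidiagonal.1 hij, map_mul]
    obtain ⟨a, ha, b, hb, hab⟩ := Submodule.mem_sup.1 (hf ij.2)
    rw [← hab, mul_add]
    refine add_mem (Ideal.mem_sup_left (Ideal.mul_mem_left _ _ ha)) (Ideal.mem_sup_right ?_)
    rw [add_assoc, pow_add, Ideal.map_mul]
    exact Ideal.mul_mem_mul (Ideal.mem_map_of_mem _ (g.2 ij.1)) hb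

theorem Ideal.leadingForms_mono {J J' : Ideal S} (h : J ≤ J') :
    I.leadingForms J ≤ I.leadingForms J' :=
  fun _ hf n ↦ sup_le_sup_right h _ (hf n)

/-- If `R` is dense in `S` for the `I`-adic topology, an ideal of `S` is contained in the closure of
any smaller ideal with the same leading forms. -/
theorem Ideal.le_sup_map_pow_of_leadingForms_le
    (h : ∀ x : S, ∃ r : R, x - algebraMap R S r ∈ I.map (algebraMap R S)) {J J' : Ideal S}
    (hJ : J ≤ J') (hl : I.leadingForms J' ≤ I.leadingForms J) (n : ℕ) :
    J' ≤ J ⊔ (I ^ n).map (algebraMap R S) := by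
  induction n with
  | zero => simp [Ideal.map_top]
  | succ n ih =>
    intro y hy
    obtain ⟨a, ha, z, hz, rfl⟩ := Submodule.mem_sup.1 (ih hy)
    have hz' : z ∈ J' := by simpa using sub_mem hy (hJ ha)
    obtain ⟨r, hr, hzr⟩ := Ideal.exists_sub_mem_map_pow_succ h n hz
    -- The error `z` lies in `J'` and has order at least `n`, so its degree `n` part `r` is a
    -- leading form of `J'`, hence of `J`.
    have hmem : (⟨Polynomial.monomial n r, reesAlgebra.monomial_mem.2 hr⟩ : reesAlgebra I) ∈
        I.leadingForms J' := by
      intro k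
      rw [Polynomial.coeff_monomial]
      split_ifs with hk
      · subst hk
        have := sub_mem (Ideal.mem_sup_left hz') (Ideal.mem_sup_right hzr) (H := J' ⊔ _)
        rwa [sub_sub_cancel] at this
      · simp
    have hr' := hl hmem n
    simp only [Polynomial.coeff_monomial, if_true] at hr'
    have := add_mem hr' (Ideal.mem_sup_right hzr)
    rw [add_sub_cancel] at this
    exact add_mem (Ideal.mem_sup_left ha) this

/-- If `R` is Noetherian and dense in `S` for the `I`-adic topology, and all finitely generated
ideals of `S` are closed, then `S` is Noetherian. -/
theorem isNoetherianRing_of_isClosed_fg [IsNoetherianRing R]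
    (h : ∀ x : S, ∃ r : R, x - algebraMap R S r ∈ I.map (algebraMap R S))
    (hc : ∀ J : Ideal S, J.FG → ∀ x, (∀ n, x ∈ J ⊔ (I ^ n).map (algebraMap R S)) → x ∈ J) :
    IsNoetherianRing S := by
  refine (isNoetherianRing_iff_ideal_fg S).2 fun K ↦ ?_
  -- Among finitely generated subideals of `K`, choose one with maximal leading forms; adjoining any
  -- `x ∈ K` cannot enlarge them.
  obtain ⟨_, ⟨J, ⟨hJ, hJK⟩, rfl⟩, hmax⟩ := set_has_maximal_iff_noetherian.2
    (inferInstance : IsNoetherianRing (reesAlgebra I))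
    (I.leadingForms '' {J : Ideal S | J.FG ∧ J ≤ K}) ⟨_, ⊥, ⟨Submodule.fg_bot, bot_le⟩, rfl⟩
  suffices K = J from this ▸ hJ
  refine le_antisymm (fun x hx ↦ hc J hJ x fun n ↦ ?_) hJK
  have hle : J ≤ J ⊔ Ideal.span {x} := le_sup_left
  refine Ideal.le_sup_map_pow_of_leadingForms_le h hle ?_ n
    (Ideal.mem_sup_right (Ideal.mem_span_singleton_self x))
  refine of_not_not fun hlt ↦ hmax _ ⟨J ⊔ Ideal.span {x}, ⟨Submodule.FG.sup hJ (Submodule.fg_span_singleton x),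
    sup_le hJK ((Ideal.span_singleton_le_iff_mem _).2 hx)⟩, rfl⟩
    ⟨Ideal.leadingForms_mono hle, hlt⟩

/-- Ideals of a Noetherian local ring are closed. -/
theorem IsLocalRing.mem_of_forall_mem_sup_pow [IsNoetherianRing S] [IsLocalRing S] {I : Ideal S}
    (hI : I ≠ ⊤) (J : Ideal S) {x : S} (hx : ∀ n, x ∈ J ⊔ I ^ n) : x ∈ J := by
  -- Krull's intersection theorem for `S ⧸ J`.
  have h := Ideal.iInf_pow_smul_eq_bot_of_isLocalRing (M := S ⧸ J) I hI
  rw [← Submodule.Quotient.mk_eq_zero, ← Submodule.mem_bot S, ← h, Submodule.mem_iInf]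
  intro n
  obtain ⟨a, ha, b, hb, rfl⟩ := Submodule.mem_sup.1 (hx n)
  rw [Submodule.Quotient.mk_add, (Submodule.Quotient.mk_eq_zero J).2 ha, zero_add]
  have : Submodule.Quotient.mk b = b • (Submodule.Quotient.mk 1 : S ⧸ J) := by
    rw [← Submodule.Quotient.mk_smul, smul_eq_mul, mul_one]
  rw [this]
  exact Submodule.smul_mem_smul hb trivial

end adic

/-! ### The Henselization is Noetherian -/

namespace Henselization

open IsLocalRing

variable {R : Type u} [CommRing R] [IsLocalRing R]

theorem exists_rep_mem_map {I : Ideal R} {x : Henselization R}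
    (hx : x ∈ I.map (algebraMap R (Henselization R))) : ∃ (j : PointedEtaleNbhd R)
      (a : j.carrier), a ∈ I.map (algebraMap R _) ∧ ι j a = x := by
  induction hx using Submodule.span_induction with
  | mem x hx =>
    obtain ⟨r, hr, rfl⟩ := hx
    exact ⟨Classical.arbitrary _, algebraMap R _ r, Ideal.mem_map_of_mem _ hr, (ι _).commutes r⟩
  | zero => exact ⟨Classical.arbitrary _, 0, zero_mem _, map_zero _⟩
  | add x y _ _ hx hy =>
    obtain ⟨i, a, ha, rfl⟩ := hx
    obtain ⟨j, b, hb, rfl⟩ := hy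
    obtain ⟨k, ⟨f⟩, ⟨g⟩⟩ := PointedEtaleNbhd.exists_algHom_to_common i j
    refine ⟨k, f a + g b, add_mem ?_ ?_, by rw [map_add, ι_map, ι_map]⟩
    exacts [f.apply_mem_map_algebraMap ha, g.apply_mem_map_algebraMap hb]
  | smul s x _ hx =>
    obtain ⟨i, a, ha, rfl⟩ := hx
    obtain ⟨j, b, rfl⟩ := exists_rep s
    obtain ⟨k, ⟨f⟩, ⟨g⟩⟩ := PointedEtaleNbhd.exists_algHom_to_common i j
    exact ⟨k, g b * f a, Ideal.mul_mem_left _ _ (f.apply_mem_map_algebraMap ha),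
      by rw [map_mul, ι_map, ι_map, smul_eq_mul]⟩

/-- Approximate `a` by some `r` in `R` modulo the `n`-th power. Membership in the colimit holds at a
finite stage `l`, so the image of `r` lies in the extended power there, and faithful flatness of `R
→ l` brings this back to `R`. -/
theorem ι_mem_map_pow_iff {j : PointedEtaleNbhd R} {n : ℕ} {a : j.carrier} :
    ι j a ∈ ((maximalIdeal R) ^ n).map (algebraMap R (Henselization R)) ↔
      a ∈ ((maximalIdeal R) ^ n).map (algebraMap R j.carrier) := by
  refine ⟨fun h ↦ ?_, fun h ↦ ?_⟩
  · obtain ⟨i, b, hb, hba⟩ := exists_rep_mem_map h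
    obtain ⟨k, ⟨f⟩, ⟨g⟩⟩ := PointedEtaleNbhd.exists_algHom_to_common j i
    have : ι k (f a) = ι k (g b) := by rw [ι_map, ι_map, hba]
    obtain ⟨l, q, hl⟩ := exists_map_eq_of_ι_eq this
    have hl' : q.comp f a ∈ ((maximalIdeal R) ^ n).map (algebraMap R l.carrier) := by
      rw [AlgHom.comp_apply, hl]
      exact (q.comp g).apply_mem_map_algebraMap hb
    obtain ⟨r, hr⟩ := Ideal.exists_sub_mem_map_pow (I := maximalIdeal R) (fun x ↦ by
      rw [j.isPointedEtale_carrier.map_maximalIdeal]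
      exact j.isPointedEtale_carrier.exists_sub_mem_maximalIdeal x) n a
    have hr' := (q.comp f).apply_mem_map_algebraMap hr
    rw [map_sub, AlgHom.commutes] at hr'
    have := sub_mem hl' hr'
    rw [sub_sub_cancel, l.isPointedEtale_carrier.algebraMap_mem_map_iff] at this
    simpa using add_mem hr (Ideal.mem_map_of_mem (algebraMap R _) this)
  · exact (ι j).apply_mem_map_algebraMap h

variable (R) in
instance isNoetherianRing [IsNoetherianRing R] : IsNoetherianRing (Henselization R) := by
  refine isNoetherianRing_of_isClosed_fg (I := maximalIdeal R) exists_sub_mem_map_maximalIdeal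
    fun J hJ x hx ↦ ?_
  obtain ⟨σ, _, g, hg⟩ : ∃ (σ : Type) (_ : Finite σ) (g : σ → Henselization R),
      Ideal.span (Set.range g) = J := by
    obtain ⟨n, g, hg⟩ := Submodule.fg_iff_exists_fin_generating_family.1 hJ
    exact ⟨Fin n, inferInstance, g, hg⟩
  -- Represent `x` (at `none`) and the generators of `J` in one neighborhood, which is Noetherian
  -- local, so that its ideals are closed.
  obtain ⟨j, a, ha⟩ := exists_common_rep (fun s : Option σ ↦ s.elim x g)
  let A := j.carrier
  let J' : Ideal A := Ideal.span (Set.range fun s ↦ a (some s))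
  have hJ' : J'.map (ι j) = J := by
    rw [Ideal.map_span, ← Set.range_comp, ← hg]
    congr 2
    ext s
    exact ha (some s)
  have hx' : ι j (a none) = x := ha none
  suffices a none ∈ J' by
    rw [← hx', ← hJ']
    exact Ideal.mem_map_of_mem _ this
  refine mem_of_forall_mem_sup_pow (Ideal.IsPrime.ne_top' (I := maximalIdeal A)) J' fun n ↦ ?_
  obtain ⟨y, hy, z, hz, hyz⟩ := Submodule.mem_sup.1 (hx n)
  rw [← hJ'] at hy
  obtain ⟨b, hb, hyb⟩ :=
    Ideal.exists_mem_sub_mem_map_pow (ι j) exists_sub_mem_map_maximalIdeal n hy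
  have hab : ι j (a none - b) ∈ ((maximalIdeal R) ^ n).map (algebraMap R (Henselization R)) := by
    rw [map_sub, hx', ← hyz, add_sub_right_comm]
    exact add_mem hyb hz
  rw [ι_mem_map_pow_iff, Ideal.map_pow, j.isPointedEtale_carrier.map_maximalIdeal] at hab
  simpa using add_mem (Ideal.mem_sup_left hb) (Ideal.mem_sup_right hab)

end Henselization

/-! ### Retracts of extended modules -/

/-- If `A` is flat and unramified over `R`, every finite `A`-module `V` is a retract of `A ⊗[R] M`
for some finitely generated `R`-submodule `M` of `V`. -/
theorem Algebra.FormallyUnramified.exists_section_of_flat {R : Type u} {A : Type v} {V : Type w}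
    [CommRing R] [CommRing A] [Algebra R A] [Algebra.EssFiniteType R A]
    [Algebra.FormallyUnramified R A] [Module.Flat R A] [AddCommGroup V] [Module R V] [Module A V]
    [IsScalarTower R A V] [Module.Finite A V] :
    ∃ (M : Submodule R V) (s : V →ₗ[A] A ⊗[R] M), Module.Finite R M ∧
      ∀ v, M.subtype.liftBaseChange A (s v) = v := by
  obtain ⟨T, hT⟩ := Module.Finite.fg_top (R := A) (M := V)
  -- `sec R A V` is the section of `A ⊗[R] V → V` given by the separability element; its values on
  -- the generators involve finitely many tensors.
  obtain ⟨M, hM, hTM⟩ := TensorProduct.exists_finite_submodule_right_of_setFinite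
    (sec R A V '' T) (T.finite_toSet.image _)
  let q : A ⊗[R] M →ₗ[A] A ⊗[R] V := M.subtype.baseChange A
  have hq : Function.Injective q :=
    Module.Flat.lTensor_preserves_injective_linearMap M.subtype M.injective_subtype
  have hrange (v : V) : sec R A V v ∈ LinearMap.range q := by
    have : (⊤ : Submodule A V) ≤ (LinearMap.range q).comap (sec R A V) := by
      rw [← hT, Submodule.span_le]
      intro t ht
      exact hTM ⟨t, ht, rfl⟩
    exact this trivial
  refine ⟨M, (LinearEquiv.ofInjective q hq).symm.toLinearMap ∘ₗ
    (sec R A V).codRestrict (LinearMap.range q) hrange, hM, fun v ↦ ?_⟩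
  have hq' (x : A ⊗[R] M) : M.subtype.liftBaseChange A x =
      (LinearMap.id : V →ₗ[R] V).liftBaseChange A (q x) := by
    induction x with
    | zero => simp
    | tmul a m => simp [q]
    | add x y hx hy => simp only [map_add, hx, hy]
  have hs := LinearMap.congr_fun (comp_sec R A V) v
  rw [hq', LinearMap.comp_apply, LinearEquiv.coe_coe]
  have := (LinearEquiv.ofInjective q hq).apply_symm_apply
    ((sec R A V).codRestrict (LinearMap.range q) hrange v)
  replace this := congrArg Subtype.val this
  rw [LinearEquiv.ofInjective_apply] at this
  rw [this]
  convert! hs using 1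

/-- A finite module over `S` whose relations are defined over an algebra `A` which is flat and
unramified over `R` is a retract of a module extended from `R`. -/
theorem exists_retract_baseChange {R A : Type u} {S : Type w} {N : Type v} [CommRing R] [CommRing A]
    [CommRing S] [Algebra R A] [Algebra R S] [Algebra A S] [IsScalarTower R A S]
    [Algebra.EssFiniteType R A] [Algebra.FormallyUnramified R A] [Module.Flat R A]
    [AddCommGroup N] [Module S N] {σ τ : Type} [Fintype σ] {π : (σ → S) →ₗ[S] N}
    (hπ : Function.Surjective π) {a : τ → σ → A}
    (ha : LinearMap.ker π = Submodule.span S (Set.range fun k i ↦ algebraMap A S (a k i))) :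
    ∃ (M : Type u) (_ : AddCommGroup M) (_ : Module R M) (i : N →ₗ[S] S ⊗[R] M)
      (p : S ⊗[R] M →ₗ[S] N), Module.Finite R M ∧ p ∘ₗ i = LinearMap.id := by
  classical
  let : Module A N := Module.compHom N (algebraMap A S)
  let : Module R N := Module.compHom N (algebraMap R S)
  have : IsScalarTower A S N := .of_algebraMap_smul fun _ _ ↦ rfl
  have : IsScalarTower R S N := .of_algebraMap_smul fun _ _ ↦ rfl
  have : IsScalarTower R A N := .of_algebraMap_smul fun r n ↦ by
    rw [← algebraMap_smul S (algebraMap R A r) n, ← IsScalarTower.algebraMap_apply,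
      algebraMap_smul]
  let K : Submodule A (σ → A) := Submodule.span A (Set.range a)
  -- The `A`-module with the same generators and relations as `N`.
  let V := (σ → A) ⧸ K
  let e (i : σ) : V := K.mkQ (Pi.single i 1)
  obtain ⟨M, s, hM, hs⟩ :=
    Algebra.FormallyUnramified.exists_section_of_flat (R := R) (A := A) (V := V)
  let θ : A ⊗[R] M →ₗ[A] S ⊗[R] M :=
    TensorProduct.AlgebraTensorModule.map (Algebra.linearMap A S) LinearMap.id
  let i₀ : (σ → S) →ₗ[S] S ⊗[R] M := Fintype.linearCombination S fun k ↦ θ (s (e k))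
  have sum_e (x : σ → A) : ∑ k, x k • e k = K.mkQ x := by
    simp only [e, ← map_smul, ← map_sum]
    rw [← pi_eq_sum_univ' x]
  have hi₀ : LinearMap.ker π ≤ LinearMap.ker i₀ := by
    rw [ha, Submodule.span_le]
    rintro _ ⟨k, rfl⟩
    have : K.mkQ (a k) = 0 := by
      simpa using Submodule.subset_span (Set.mem_range_self k)
    simp only [SetLike.mem_coe, LinearMap.mem_ker, i₀, Fintype.linearCombination_apply,
      algebraMap_smul, ← map_smul, ← map_sum]
    rw [sum_e, this, map_zero, map_zero]
  -- The `S`-linear extension of `V → A ⊗[R] M → S ⊗[R] M`, defined through the presentation of `N`.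
  let i : N →ₗ[S] S ⊗[R] M :=
    (LinearMap.ker π).liftQ i₀ hi₀ ∘ₗ (π.quotKerEquivOfSurjective hπ).symm.toLinearMap
  have hi (x : σ → S) : i (π x) = i₀ x := by
    have : (π.quotKerEquivOfSurjective hπ).symm (π x) = (LinearMap.ker π).mkQ x := by
      rw [LinearEquiv.symm_apply_eq]; rfl
    simp only [i, LinearMap.comp_apply, LinearEquiv.coe_coe, this]
    simp
  let j₀ : (σ → A) →ₗ[A] N := Fintype.linearCombination A fun k ↦ π (Pi.single k 1)
  have hj₀ (x : σ → A) : j₀ x = π fun i ↦ algebraMap A S (x i) := by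
    simp only [j₀, Fintype.linearCombination_apply]
    conv_rhs => rw [pi_eq_sum_univ' fun i ↦ algebraMap A S (x i)]
    simp [map_sum]
  let j : V →ₗ[A] N := K.liftQ j₀ (by
    rw [Submodule.span_le]
    rintro _ ⟨k, rfl⟩
    rw [SetLike.mem_coe, LinearMap.mem_ker, hj₀, ← LinearMap.mem_ker, ha]
    exact Submodule.subset_span ⟨k, rfl⟩)
  let p : S ⊗[R] M →ₗ[S] N := ((j.restrictScalars R) ∘ₗ M.subtype).liftBaseChange S
  have hp (x : A ⊗[R] M) : p (θ x) = j (M.subtype.liftBaseChange A x) := by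
    induction x with
    | zero => simp
    | tmul a m => simp [p, θ]
    | add x y hx hy => simp only [map_add, hx, hy]
  refine ⟨M, inferInstance, inferInstance, i, p, hM, ?_⟩
  have : (p ∘ₗ i) ∘ₗ π = LinearMap.id ∘ₗ π := by
    refine LinearMap.pi_ext' fun k ↦ LinearMap.ext_ring ?_
    simp only [LinearMap.comp_apply, LinearMap.single_apply, hi, LinearMap.id_apply, i₀,
      Fintype.linearCombination_apply_single, one_smul, hp, hs]
    change j₀ (Pi.single k 1) = _
    simp [j₀]
  rwa [LinearMap.cancel_right hπ] at this

theorem IsDirectSummand.of_retract {S : Type u} [CommRing S] {N : Type v} [AddCommGroup N]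
    [Module S N] {L : Type w} [AddCommGroup L] [Module S L] {i : N →ₗ[S] L} {p : L →ₗ[S] N}
    (h : p ∘ₗ i = LinearMap.id) : IsDirectSummand S N L := by
  have h' (n : N) : p (i n) = n := LinearMap.congr_fun h n
  refine ⟨LinearMap.range i, LinearMap.ker p, ⟨?_, ?_⟩,
    ⟨LinearEquiv.ofInjective i (Function.LeftInverse.injective h')⟩⟩
  · rw [Submodule.disjoint_def]
    rintro _ ⟨n, rfl⟩ hn
    rw [LinearMap.mem_ker, h'] at hn
    rw [hn, map_zero]
  · rw [codisjoint_iff, Submodule.eq_top_iff']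
    intro x
    exact Submodule.mem_sup.2 ⟨i (p x), ⟨p x, rfl⟩, x - i (p x), by simp [h'], by simp⟩

theorem corollary3p5 {R : Type u} [CommRing R] [IsLocalRing R] [IsNoetherianRing R]
    (N : Type v) [AddCommGroup N] [Module (Henselization R) N]
    [Module.Finite (Henselization R) N] :
    ∃ (L : Type u) (_ : AddCommGroup L) (_ : Module (Henselization R) L),
      Module.Finite (Henselization R) L ∧ IsExtended R (Henselization R) L ∧
        IsDirectSummand (Henselization R) N L := by
  obtain ⟨n, π, hπ⟩ := Module.Finite.exists_fin' (Henselization R) N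
  obtain ⟨m, g, hg⟩ := Submodule.fg_iff_exists_fin_generating_family.1
    (IsNoetherian.noetherian (LinearMap.ker π))
  obtain ⟨j, a, ha⟩ := Henselization.exists_common_rep fun ki : Fin m × Fin n ↦ g ki.1 ki.2
  let _ : Algebra j.carrier (Henselization R) := (Henselization.ι j).toAlgebra
  have : IsScalarTower R j.carrier (Henselization R) :=
    .of_algebraMap_eq fun r ↦ ((Henselization.ι j).commutes r).symm
  have hj := j.isPointedEtale_carrier
  have := hj.essFiniteType
  have := hj.formallyUnramified
  have := hj.flat
  have hker : LinearMap.ker π = Submodule.span (Henselization R)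
      (Set.range fun k i ↦ algebraMap j.carrier (Henselization R) (a (k, i))) := by
    rw [← hg]
    congr 2
    ext k i
    exact (ha (k, i)).symm
  obtain ⟨M, _, _, i, p, _, hpi⟩ := exists_retract_baseChange (R := R) hπ hker
  exact ⟨Henselization R ⊗[R] M, inferInstance, inferInstance, inferInstance,
    ⟨M, inferInstance, inferInstance, inferInstance, ⟨.refl _ _⟩⟩, .of_retract hpi⟩
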